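/- Let $q$ be an odd prime power, $\chi$ the quadratic character of $\mathbb{F}_q$, $\gamma\in\mathbb{F}_q^*$ a non-square, and $\epsilon\in\{+1,-1\}$. Put $\tau_{+1}=1$, $\tau_{-1}=\gamma$ and $M^\epsilon=\mathrm{diag}(1,\dots,1,\tau_\epsilon)\in\mathbb{F}_q^{n\times n}$; a symmetric bilinear form on $\mathbb{F}_q^n$ has type $\epsilon$ if it is isometric to the form with matrix $M^\epsilon$. For a symmetric matrix $M$, a subspace $C\subseteq\mathbb{F}_q^n$ is $M$-LCD if $C\cap\{y : xMy^T=0\ \text{for all } x\in C\}=\{0\}$. Let $L^\epsilon(n,k,q)$ be the number of $k$-dimensional $M^\epsilon$-LCD subspaces of $\mathbb{F}_q^n$, and $L(n,k,q)$ the number of $k$-dimensional $I$-LCD subspaces (LCD codes for the standard inner product). Let $\left[\begin{smallmatrix} m\\ r\end{smallmatrix}\right]_x=\prod_{i=0}^{r-1}\frac{x^{m-i}-1}{x^{i+1}-1}$ denote the Gaussian binomial coefficient. Then for all $1\le k<n$, $$L^\epsilon(n,k,q)=\begin{cases} q^{\frac{k(n-k)-1}{2}}\left(q^{n/2}-\chi\big((-1)^{n/2}\tau_\epsilon\big)\right)\left[\begin{smallmatrix}\frac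 n2-1\\ \frac{k-1}2\end{smallmatrix}\right]_{q^2}, & k\text{ odd},\ n\text{ even},\\[4pt] L(n,k,q), & \text{otherwise},\end{cases}$$ where $$L(n,k,q)=\begin{cases} q^{\frac{k(n-k)-1}{2}}\left(q^{n/2}-\chi\big((-1)^{n/2}\big)\right)\left[\begin{smallmatrix}\frac n2-1\\ \frac{k-1}2\end{smallmatrix}\right]_{q^2}, & k\text{ odd},\ n\text{ even},\\[4pt] q^{\frac{(k+1)(n-k)}{2}}\left[\begin{smallmatrix}\frac{n-1}2\\ \frac{k-1}2\end{smallmatrix}\right]_{q^2}, & k\text{ odd},\ n\text{ odd},\\[4pt] q^{\frac{k(n-k+1)}{2}}\left[\begin{smallmatrix}\frac{n-1}2\\ \frac k2\end{smallmatrix}\right]_{q^2}, & k\text{ even},\ n\text{ odd},\\[4pt] q^{\frac{k(n-k)}{2}}\left[\begin{smallmatrix}\frac n2\\ \frac k2\end{smallmatrix}\right]_{q^2}, & k\text{ even},\ n\text{ even}.\end{cases}$$ In particular $L^{+1}(n,k,q)=L(n,k,q)$. Moreover, for every symmetric form of type $\epsilon$ on $\mathbb{F}_q^n$, with matrix $M$,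 the number of $k$-dimensional $M$-LCD subspaces equals $L^\epsilon(n,k,q)$. -/

import Mathlib

namespace LCDMass

/-- The Gaussian binomial coefficient `[m choose r]_x = ∏_{i<r} (x^(m-i) - 1) / (x^(i+1) - 1)`
(for `r > m` the factor `i = m` vanishes, so the value is `0`). -/
noncomputable def gaussBinom (m r : ℕ) (x : ℚ) : ℚ :=
  ∏ i ∈ Finset.range r, (x ^ (m - i) - 1) / (x ^ (i + 1) - 1)

variable {F : Type*} [Field F] {n : ℕ}

/-- The `M`-dual code `{y | x M yᵀ = 0 for all x ∈ C}`. -/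
noncomputable def dualCode (M : Matrix (Fin n) (Fin n) F) (C : Submodule F (Fin n → F)) :
    Submodule F (Fin n → F) :=
  (Matrix.toBilin' M).orthogonal C

/-- The `M`-hull `C ∩ C^{⊥_M}`. -/
noncomputable def hull (M : Matrix (Fin n) (Fin n) F) (C : Submodule F (Fin n → F)) :
    Submodule F (Fin n → F) :=
  C ⊓ dualCode M C

/-- `C` is an `M`-LCD code: its `M`-hull is trivial. -/
def IsLCD (M : Matrix (Fin n) (Fin n) F) (C : Submodule F (Fin n → F)) : Prop :=
  hull M C = ⊥

/-- The number of `k`-dimensional `M`-LCD codes in `F^n`. -/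
noncomputable def lcdCount (M : Matrix (Fin n) (Fin n) F) (k : ℕ) : ℕ :=
  Set.ncard {C : Submodule F (Fin n → F) | Module.finrank F C = k ∧ IsLCD M C}

/-- `τ_ε`: the last diagonal entry, hence the determinant, of the form of type `ε`. -/
def tau (γ : F) (ε : ℤˣ) : F := if ε = 1 then 1 else γ

/-- `M^ε = diag(1, …, 1, τ_ε)`. -/
def structMatrix (n : ℕ) (γ : F) (ε : ℤˣ) : Matrix (Fin n) (Fin n) F :=
  Matrix.diagonal fun i => if i.val + 1 = n then tau γ ε else 1

/-- The symmetric form with matrix `M` has type `ε`: it is isometric to `M^ε`. -/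
def IsOfType (γ : F) (ε : ℤˣ) (M : Matrix (Fin n) (Fin n) F) : Prop :=
  ∃ P : GL (Fin n) F, M = P.val * structMatrix n γ ε * P.val.transpose

variable (F)

/-- `L(n,k,q)`: the number of `k`-dimensional LCD codes of length `n` for the standard inner
product. -/
noncomputable def stdCount (n k : ℕ) : ℕ :=
  lcdCount (1 : Matrix (Fin n) (Fin n) F) k

variable {F}

/-- `L^ε(n,k,q)`: the number of `k`-dimensional `M^ε`-LCD codes of length `n`. -/
noncomputable def typeCount (γ : F) (ε : ℤˣ) (n k : ℕ) : ℕ :=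
  lcdCount (structMatrix n γ ε) k

/-- The closed expression for `k` odd and `n` even, for a form of determinant class `d`. Both
halves in the exponents are exact. -/
noncomputable def oddEvenMass [Fintype F] [DecidableEq F] (n k : ℕ) (d : F) : ℚ :=
  (Fintype.card F : ℚ) ^ ((k * (n - k) - 1) / 2) *
    ((Fintype.card F : ℚ) ^ (n / 2) - (quadraticChar F ((-1) ^ (n / 2) * d) : ℚ)) *
    gaussBinom (n / 2 - 1) ((k - 1) / 2) ((Fintype.card F : ℚ) ^ 2)

variable (F)

/-- The four-case closed expression for the number of `[n,k]_q` LCD codes, `q = |F|` odd and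
`1 ≤ k < n`; all divisions are exact. -/
noncomputable def carletMass [Fintype F] [DecidableEq F] (n k : ℕ) : ℚ :=
  if Odd k then
    if Even n then oddEvenMass n k (1 : F)
    else
      (Fintype.card F : ℚ) ^ ((k + 1) * (n - k) / 2) *
        gaussBinom ((n - 1) / 2) ((k - 1) / 2) ((Fintype.card F : ℚ) ^ 2)
  else
    if Even n then
      (Fintype.card F : ℚ) ^ (k * (n - k) / 2) *
        gaussBinom (n / 2) (k / 2) ((Fintype.card F : ℚ) ^ 2)
    else
      (Fintype.card F : ℚ) ^ (k * (n - k + 1) / 2) *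
        gaussBinom ((n - 1) / 2) (k / 2) ((Fintype.card F : ℚ) ^ 2)

end LCDMass

/-! A subspace is LCD exactly when the form restricts to it nondegenerately, so the task is to count
nondegenerate subspaces `C` of dimension `k`. If `C` has discriminant class `δ`, Witt's theorem
would give `|O(V)| / (|O(C)| |O(C^⊥)|)` of them. The proof reaches this quotient without orthogonal
groups: `orthOrder` is only a formula, and orthogonal frames with prescribed norms take the place of
group elements. Jacobi sums count the solutions of diagonal equations (`diagCount_eq`), hence the
vectors of given nonzero norm. This number is a ratio of consecutive values of `orthOrder`
(`repCount_mul_orthOrder`). Choosing frame vectors one at a time telescopes the ratios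
(`card_frame_mul_orthOrder`). Each frame spans exactly one nondegenerate subspace, and all subspaces
of class `δ` carry equally many frames, so a division gives `ncard_nondegSubspaces`. Adding the
terms for `δ = ±1` gives Gaussian binomials in `q²`. The discriminant of the ambient form survives
only for odd `k` and even `n`. Isometric forms have discriminants differing by a square, so the
count depends only on the type. -/

namespace LCDMass

/-! ### Sums of the quadratic character over values of `a x²`. -/

section CharacterSums

variable {F : Type*} [Field F] [Fintype F] [DecidableEq F]

lemma quadraticChar_mul_self {a : F} (ha : a ≠ 0) : quadraticChar F a * quadraticChar F a = 1 := by
  rw [← sq]; exact quadraticChar_sq_one ha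

/-- The number of `x` with `a x² = t` is `1 + χ(a t)`. -/
lemma sum_ite_mul_sq_eq (hF : ringChar F ≠ 2) {a : F} (ha : a ≠ 0) (t : F) :
    ∑ x : F, (if a * x ^ 2 = t then (1 : ℤ) else 0) =
      1 + quadraticChar F a * quadraticChar F t := by
  have h := quadraticChar_card_sqrts hF (a⁻¹ * t)
  have hinv : quadraticChar F a⁻¹ = quadraticChar F a := by
    have h1 : quadraticChar F a * quadraticChar F a⁻¹ = 1 := by
      rw [← map_mul, mul_inv_cancel₀ ha, map_one]
    calc quadraticChar F a⁻¹
        = (quadraticChar F a * quadraticChar F a) * quadraticChar F a⁻¹ := by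
          rw [quadraticChar_mul_self ha, one_mul]
      _ = quadraticChar F a := by rw [mul_assoc, h1, mul_one]
  rw [map_mul, hinv] at h
  rw [Finset.sum_boole, add_comm, ← h]
  norm_cast
  congr 1
  ext x
  simp only [Finset.mem_filter, Finset.mem_univ, true_and, Set.mem_toFinset, Set.mem_ofPred_eq]
  rw [eq_inv_mul_iff_mul_eq₀ ha]

/-- Summing a function over the values of `a x²`. -/
lemma sum_comp_mul_sq (hF : ringChar F ≠ 2) {a : F} (ha : a ≠ 0) (f : F → ℤ) :
    ∑ x : F, f (a * x ^ 2) =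
      ∑ u : F, f u * (1 + quadraticChar F a * quadraticChar F u) := by
  simp_rw [← sum_ite_mul_sq_eq hF ha, Finset.mul_sum]
  rw [Finset.sum_comm]
  refine Finset.sum_congr rfl fun x _ => ?_
  simp

/-- For `t ≠ 0` the scaling `u = t x` gives the Jacobi sum of `χ` with `χ = χ⁻¹`, which is `-χ(-1)`.
For `t = 0` each nonzero `u` contributes `χ(-1)`. -/
lemma sum_quadraticChar_mul_sub (hF : ringChar F ≠ 2) (t : F) :
    ∑ u : F, quadraticChar F (t - u) * quadraticChar F u =
      quadraticChar F (-1) * ((Fintype.card F : ℤ) * (if t = 0 then 1 else 0) - 1) := by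
  split_ifs with ht
  · subst ht
    have : ∀ u : F, quadraticChar F (0 - u) * quadraticChar F u =
        quadraticChar F (-1) * (1 - if u = 0 then 1 else 0) := by
      intro u
      rw [zero_sub, neg_eq_neg_one_mul, map_mul]
      split_ifs with hu
      · simp [hu]
      · rw [mul_assoc, quadraticChar_mul_self hu]; ring
    simp_rw [this, ← Finset.mul_sum]
    simp
  · have hJ := jacobiSum_nontrivial_inv (quadraticChar_ne_one hF)
    rw [(quadraticChar_isQuadratic F).inv, jacobiSum] at hJ
    rw [mul_zero, zero_sub, mul_neg_one, ← hJ, ← Equiv.sum_comp (Equiv.mulLeft₀ t ht)]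
    refine Finset.sum_congr rfl fun x _ => ?_
    change quadraticChar F (t - t * x) * quadraticChar F (t * x) = _
    rw [show t - t * x = t * (1 - x) by ring, map_mul, map_mul,
      mul_mul_mul_comm, quadraticChar_mul_self ht]
    ring

lemma sum_quadraticChar_sub_mul_sq (hF : ringChar F ≠ 2) {a : F} (ha : a ≠ 0) (t : F) :
    ∑ x : F, quadraticChar F (t - a * x ^ 2) =
      quadraticChar F (-1) * quadraticChar F a *
        ((Fintype.card F : ℤ) * (if t = 0 then 1 else 0) - 1) := by
  rw [sum_comp_mul_sq hF ha fun u => quadraticChar F (t - u)]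
  have h0 : ∑ u : F, quadraticChar F (t - u) = 0 := by
    rw [← quadraticChar_sum_zero hF]
    exact Equiv.sum_comp (Equiv.subLeft t) (fun u => quadraticChar F u)
  simp_rw [mul_add, mul_one, Finset.sum_add_distrib, h0, zero_add]
  rw [mul_comm (quadraticChar F (-1)), mul_assoc, ← sum_quadraticChar_mul_sub hF, Finset.mul_sum]
  exact Finset.sum_congr rfl fun x _ => by ring

end CharacterSums

/-! ### Solutions of diagonal quadratic equations. -/

section DiagonalEquations

variable {F : Type*} [Field F]

/-- The number of solutions of the diagonal equation `∑ aᵢ xᵢ² = t`. -/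
noncomputable def diagCount {m : ℕ} (a : Fin m → F) (t : F) : ℕ :=
  Nat.card {x : Fin m → F // ∑ i, a i * x i ^ 2 = t}

lemma diagCount_succ [Fintype F] {m : ℕ} (a : Fin (m + 1) → F) (t : F) :
    diagCount a t = ∑ x : F, diagCount (fun i => a i.succ) (t - a 0 * x ^ 2) := by
  unfold diagCount
  rw [← Nat.card_sigma]
  refine Nat.card_congr
    { toFun := fun x => ⟨x.1 0, fun i => x.1 i.succ, ?_⟩
      invFun := fun p => ⟨Fin.cons p.1 p.2.1, ?_⟩
      left_inv := fun x => Subtype.ext (Fin.cons_self_tail x.1)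
      right_inv := fun p => rfl }
  · have := x.2
    rw [Fin.sum_univ_succ] at this
    exact eq_sub_of_add_eq' this
  · have := p.2.2
    simp only [Fin.sum_univ_succ, Fin.cons_zero, Fin.cons_succ, this]
    ring

lemma diagCount_zero [DecidableEq F] (a : Fin 0 → F) (t : F) : diagCount a t = if t = 0 then 1 else 0 := by
  unfold diagCount
  split_ifs with h
  · subst h
    simp
  · rw [Nat.card_eq_zero]
    left
    exact ⟨fun x => h (by simpa using x.2.symm)⟩

/-- The number of representations of `t` by a nondegenerate diagonal form, in even and in odd
dimension. -/
lemma diagCount_eq [Fintype F] [DecidableEq F] (hF : ringChar F ≠ 2) (m : ℕ) :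
    (∀ (a : Fin (2 * m) → F), (∀ i, a i ≠ 0) → ∀ t,
      (Fintype.card F : ℤ) * diagCount a t = (Fintype.card F : ℤ) ^ (2 * m) +
        quadraticChar F (-1) ^ m * (∏ i, quadraticChar F (a i)) * (Fintype.card F : ℤ) ^ m *
          ((Fintype.card F : ℤ) * (if t = 0 then 1 else 0) - 1)) ∧
    (∀ (a : Fin (2 * m + 1) → F), (∀ i, a i ≠ 0) → ∀ t,
      (diagCount a t : ℤ) = (Fintype.card F : ℤ) ^ (2 * m) +
        quadraticChar F (-1) ^ m * (∏ i, quadraticChar F (a i)) * (Fintype.card F : ℤ) ^ m *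
          quadraticChar F t) := by
  have hq : (Fintype.card F : ℤ) ≠ 0 := by exact_mod_cast Fintype.card_ne_zero
  -- Splitting off one variable, the indicator term sums to the number of `x` with `a₀ x² = t`,
  -- which is `1 + χ(a₀ t)`.
  have odd_of_even : ∀ m : ℕ, (∀ (a : Fin (2 * m) → F), (∀ i, a i ≠ 0) → ∀ t,
      (Fintype.card F : ℤ) * diagCount a t = (Fintype.card F : ℤ) ^ (2 * m) +
        quadraticChar F (-1) ^ m * (∏ i, quadraticChar F (a i)) * (Fintype.card F : ℤ) ^ m *
          ((Fintype.card F : ℤ) * (if t = 0 then 1 else 0) - 1)) →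
      (∀ (a : Fin (2 * m + 1) → F), (∀ i, a i ≠ 0) → ∀ t,
      (diagCount a t : ℤ) = (Fintype.card F : ℤ) ^ (2 * m) +
        quadraticChar F (-1) ^ m * (∏ i, quadraticChar F (a i)) * (Fintype.card F : ℤ) ^ m *
          quadraticChar F t) := by
    intro m ih a ha t
    apply mul_left_cancel₀ hq
    rw [diagCount_succ, Nat.cast_sum, Finset.mul_sum]
    simp_rw [ih (fun i => a i.succ) (fun i => ha _)]
    rw [Finset.sum_add_distrib, ← Finset.mul_sum, Finset.sum_sub_distrib, ← Finset.mul_sum]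
    have := sum_ite_mul_sq_eq hF (ha 0) t
    simp_rw [sub_eq_zero, eq_comm (a := t)]
    rw [this, Fin.prod_univ_succ]
    simp
    ring
  induction m with
  | zero =>
    -- The factor `q` on the left avoids `q^(m-1)` on the right, so the empty form can start the
    -- induction.
    have h0 : ∀ (a : Fin (2 * 0) → F), (∀ i, a i ≠ 0) → ∀ t,
      (Fintype.card F : ℤ) * diagCount a t = (Fintype.card F : ℤ) ^ (2 * 0) +
        quadraticChar F (-1) ^ 0 * (∏ i, quadraticChar F (a i)) * (Fintype.card F : ℤ) ^ 0 *
          ((Fintype.card F : ℤ) * (if t = 0 then 1 else 0) - 1) := by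
      intro a _ t
      rw [diagCount_zero]
      simp
    exact ⟨h0, odd_of_even 0 h0⟩
  | succ m ih =>
    have h1 : ∀ (a : Fin (2 * m + 1 + 1) → F), (∀ i, a i ≠ 0) → ∀ t,
      (Fintype.card F : ℤ) * diagCount a t = (Fintype.card F : ℤ) ^ (2 * (m + 1)) +
        quadraticChar F (-1) ^ (m + 1) * (∏ i, quadraticChar F (a i)) *
          (Fintype.card F : ℤ) ^ (m + 1) *
          ((Fintype.card F : ℤ) * (if t = 0 then 1 else 0) - 1) := by
      intro a ha t
      rw [diagCount_succ, Nat.cast_sum]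
      simp_rw [ih.2 (fun i => a i.succ) (fun i => ha _)]
      rw [Finset.sum_add_distrib, ← Finset.mul_sum, sum_quadraticChar_sub_mul_sq hF (ha 0),
        Fin.prod_univ_succ fun i => quadraticChar F (a i)]
      simp only [Finset.sum_const, Finset.card_univ, nsmul_eq_mul]
      ring
    exact ⟨h1, odd_of_even (m + 1) h1⟩

end DiagonalEquations

/-! ### The numerical orders of orthogonal groups. -/

section OrthogonalOrder

/-- `∏_{i=1}^m (x^i - 1)`. -/
def qFactorial (x : ℚ) (m : ℕ) : ℚ := ∏ i ∈ Finset.range m, (x ^ (i + 1) - 1)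

lemma qFactorial_succ (x : ℚ) (m : ℕ) :
    qFactorial x (m + 1) = qFactorial x m * (x ^ (m + 1) - 1) :=
  Finset.prod_range_succ _ _

lemma qFactorial_pos {x : ℚ} (hx : 1 < x) (m : ℕ) : 0 < qFactorial x m :=
  Finset.prod_pos fun i _ => sub_pos.2 (one_lt_pow₀ hx (Nat.succ_ne_zero i))

/-- The order of the orthogonal group of an `n`-dimensional form over the field with `q` elements,
where `c = χ(-1)` and `e = χ(disc)`. -/
def orthOrder (q c : ℚ) (n : ℕ) (e : ℚ) : ℚ :=
  if Even n then
    2 * q ^ (n / 2 * (n / 2 - 1)) * qFactorial (q ^ 2) (n / 2) / (q ^ (n / 2) + c ^ (n / 2) * e)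
  else 2 * q ^ ((n / 2) ^ 2) * qFactorial (q ^ 2) (n / 2)

lemma orthOrder_even (q c : ℚ) (m : ℕ) (e : ℚ) : orthOrder q c (2 * m) e =
    2 * q ^ (m * (m - 1)) * qFactorial (q ^ 2) m / (q ^ m + c ^ m * e) := by
  simp [orthOrder]

lemma orthOrder_odd (q c : ℚ) (m : ℕ) (e : ℚ) :
    orthOrder q c (2 * m + 1) e = 2 * q ^ (m ^ 2) * qFactorial (q ^ 2) m := by
  have h : ¬ Even (2 * m + 1) := by simp
  have h2 : (2 * m + 1) / 2 = m := by omega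
  simp only [orthOrder, if_neg h, h2]

/-- Dividing by `q^m + c^m e` lets the even formula cover dimension 0 when `e = 1`. For `e = -1` the
denominator is 0 there, hence the shifted exponents and dimensions in the positivity lemmas below.
-/
lemma orthOrder_zero (q c : ℚ) : orthOrder q c 0 1 = 1 := by
  simp [orthOrder, qFactorial]; norm_num

lemma pow_mul_eq_or {c e : ℚ} (hc : c = 1 ∨ c = -1) (he : e = 1 ∨ e = -1) (m : ℕ) :
    c ^ m * e = 1 ∨ c ^ m * e = -1 := by
  have h : c ^ m = 1 ∨ c ^ m = -1 := by
    rcases hc with rfl | rfl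
    · simp
    · exact neg_one_pow_eq_or ℚ m
  rcases h with h | h <;> rcases he with rfl | rfl <;> simp [h]

lemma pow_add_pos {q c e : ℚ} (hq : 1 < q) (hc : c = 1 ∨ c = -1) (he : e = 1 ∨ e = -1) (m : ℕ) :
    0 < q ^ (m + 1) + c ^ (m + 1) * e := by
  have h : 1 < q ^ (m + 1) := one_lt_pow₀ hq (Nat.succ_ne_zero m)
  rcases pow_mul_eq_or hc he (m + 1) with h' | h' <;> rw [h'] <;> linarith

lemma orthOrder_pos {q c e : ℚ} (hq : 1 < q) (hc : c = 1 ∨ c = -1) (he : e = 1 ∨ e = -1)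
    (n : ℕ) : 0 < orthOrder q c (n + 1) e := by
  have h0 : 0 < q := one_pos.trans hq
  have hP := qFactorial_pos (one_lt_pow₀ hq two_ne_zero)
  obtain ⟨m, rfl | rfl⟩ := n.even_or_odd'
  · rw [orthOrder_odd]
    have := hP m
    positivity
  · rw [show 2 * m + 1 + 1 = 2 * (m + 1) by ring, orthOrder_even]
    have := hP (m + 1)
    have := pow_add_pos hq hc he m
    positivity

/-- The usual product form, from `q^(2m) - 1 = (q^m - η)(q^m + η)` with `η = ±1`. -/
lemma orthOrder_even_succ {q c e : ℚ} (hq : 1 < q) (hc : c = 1 ∨ c = -1) (he : e = 1 ∨ e = -1)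
    (m : ℕ) : orthOrder q c (2 * (m + 1)) e =
      2 * q ^ ((m + 1) * m) * (q ^ (m + 1) - c ^ (m + 1) * e) * qFactorial (q ^ 2) m := by
  rw [orthOrder_even, div_eq_iff (pow_add_pos hq hc he m).ne', qFactorial_succ,
    Nat.add_sub_cancel]
  have h1 : (c ^ (m + 1) * e) ^ 2 = 1 := by
    rcases pow_mul_eq_or hc he (m + 1) with h' | h' <;> rw [h'] <;> norm_num
  have h2 : (q ^ 2) ^ (m + 1) - 1 =
      (q ^ (m + 1) - c ^ (m + 1) * e) * (q ^ (m + 1) + c ^ (m + 1) * e) := by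
    linear_combination h1
  rw [h2]
  ring

end OrthogonalOrder

open Module (finrank Basis)

/-! ### Orthogonal bases and the complement of a non-isotropic vector. -/

section Bases

variable {F : Type*} [Field F] {V : Type*} [AddCommGroup V] [Module F V]

/-- A nondegenerate symmetric form is diagonal in a suitable basis. -/
lemma exists_diagonal_basis (hF : ringChar F ≠ 2) [Module.Finite F V] {B : LinearMap.BilinForm F V}
    (hs : B.IsSymm) (hB : B.Nondegenerate) {m : ℕ} (hm : finrank F V = m) :
    ∃ (b : Basis (Fin m) F V) (a : Fin m → F), (∀ i, a i ≠ 0) ∧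
      ∀ i j, B (b i) (b j) = Matrix.diagonal a i j := by
  subst hm
  have : Invertible (2 : F) := invertibleOfNonzero (Ring.two_ne_zero hF)
  obtain ⟨b, hb⟩ := LinearMap.BilinForm.exists_orthogonal_basis (B := B) ⟨hs.eq⟩
  refine ⟨b, fun i => B (b i) (b i),
    LinearMap.IsOrthoᵢ.not_isOrtho_basis_self_of_separatingLeft hb hB.1, fun i j => ?_⟩
  by_cases h : i = j
  · subst h; simp
  · rw [Matrix.diagonal_apply_ne _ h]; exact hb h

/-- Adjoining a non-isotropic vector to a basis of its orthogonal complement. -/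
lemma exists_basis_cons {B : LinearMap.BilinForm F V} {v : V} (hv : B v v ≠ 0) {m : ℕ}
    (b : Basis (Fin m) F (B.orthogonal (F ∙ v))) :
    ∃ b' : Basis (Fin (m + 1)) F V, ⇑b' = Fin.cons v (fun i => (b i : V)) := by
  refine ⟨Basis.mkFinCons v b ?_ ?_, Basis.coe_mkFinCons ..⟩
  · intro c y hy hc
    have h0 := hy v (Submodule.mem_span_singleton_self v)
    rw [eq_neg_of_add_eq_zero_right hc] at h0
    have h1 : B v (-(c • v)) = 0 := h0
    simpa [hv] using h1
  · intro y
    -- The Gram–Schmidt coefficient that moves `y` into the complement of `v`.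
    refine ⟨-B v y / B v v, fun z hz => ?_⟩
    obtain ⟨c, rfl⟩ := Submodule.mem_span_singleton.1 hz
    change B (c • v) (y + (-B v y / B v v) • v) = 0
    simp only [map_smul, map_add, LinearMap.smul_apply, smul_eq_mul]
    field_simp
    ring

lemma mem_orthogonal_span_singleton {B : LinearMap.BilinForm F V} {v w : V} :
    w ∈ B.orthogonal (F ∙ v) ↔ B v w = 0 := by
  refine ⟨fun h => h v (Submodule.mem_span_singleton_self v), fun h z hz => ?_⟩
  obtain ⟨c, rfl⟩ := Submodule.mem_span_singleton.1 hz
  change B (c • v) w = 0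
  simp [h]

lemma finrank_orthogonal_span_singleton [Module.Finite F V] {B : LinearMap.BilinForm F V} {v : V}
    (hv : B v v ≠ 0) : finrank F (B.orthogonal (F ∙ v)) + 1 = finrank F V := by
  obtain ⟨b', -⟩ := exists_basis_cons hv (Module.finBasis F (B.orthogonal (F ∙ v)))
  simpa using (Module.finrank_eq_card_basis b').symm

end Bases

/-! ### The discriminant class of a form. -/

section Disc

variable {F : Type*} [Field F] [Fintype F] [DecidableEq F]
variable {V : Type*} [AddCommGroup V] [Module F V]

/-- The quadratic character of the discriminant of a bilinear form. -/
noncomputable def disc [Module.Finite F V] (B : LinearMap.BilinForm F V) : ℤ :=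
  quadraticChar F (LinearMap.BilinForm.toMatrix (Module.finBasis F V) B).det

/-- A change of basis multiplies the Gram determinant by a nonzero square. -/
lemma disc_eq [Module.Finite F V] (B : LinearMap.BilinForm F V) {m : ℕ} (b : Basis (Fin m) F V) :
    disc B = quadraticChar F (LinearMap.BilinForm.toMatrix b B).det := by
  obtain rfl : m = finrank F V := by simpa using (Module.finrank_eq_card_basis b).symm
  have h := LinearMap.BilinForm.toMatrix_mul_basis_toMatrix b (Module.finBasis F V) B
  have hdet : (b.toMatrix (Module.finBasis F V)).det ≠ 0 := fun h0 => by
    have := congrArg Matrix.det (b.toMatrix_mul_toMatrix_flip (Module.finBasis F V))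
    rw [Matrix.det_mul, h0, zero_mul, Matrix.det_one] at this
    exact zero_ne_one this
  rw [disc, ← h, Matrix.det_mul, Matrix.det_mul, Matrix.det_transpose, map_mul, map_mul,
    mul_right_comm, quadraticChar_mul_self hdet, one_mul]

lemma disc_eq_one_or [Module.Finite F V] {B : LinearMap.BilinForm F V} (hB : B.Nondegenerate) :
    disc B = 1 ∨ disc B = -1 :=
  quadraticChar_dichotomy
    ((LinearMap.BilinForm.nondegenerate_iff_det_ne_zero (Module.finBasis F V)).1 hB)

lemma disc_eq_prod [Module.Finite F V] {B : LinearMap.BilinForm F V} {m : ℕ}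
    {b : Basis (Fin m) F V} {a : Fin m → F} (hb : ∀ i j, B (b i) (b j) = Matrix.diagonal a i j) :
    disc B = ∏ i, quadraticChar F (a i) := by
  have : LinearMap.BilinForm.toMatrix b B = Matrix.diagonal a := by
    ext i j
    rw [LinearMap.BilinForm.toMatrix_apply, hb]
  rw [disc_eq B b, this, Matrix.det_diagonal, map_prod]

/-- The Gram determinant is multiplicative along `V = ⟨v⟩ ⊥ v^⊥`, and `χ(B v v)` is its own inverse.
-/
lemma disc_restrict_orthogonal (hF : ringChar F ≠ 2) [Module.Finite F V]
    {B : LinearMap.BilinForm F V} (hs : B.IsSymm) (hB : B.Nondegenerate) {v : V}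
    (hv : B v v ≠ 0) :
    disc (B.restrict (B.orthogonal (F ∙ v))) = disc B * quadraticChar F (B v v) := by
  obtain ⟨b, a, -, hb⟩ := exists_diagonal_basis hF (hs.restrict (B.orthogonal (F ∙ v)))
    (B.restrict_nondegenerate_orthogonal_spanSingleton hB hs.isRefl hv) rfl
  obtain ⟨b', hb'⟩ := exists_basis_cons hv b
  have h' : ∀ i j, B (b' i) (b' j) = Matrix.diagonal (Fin.cons (B v v) a : Fin _ → F) i j := by
    intro i j
    rw [hb']
    refine Fin.cases ?_ (fun i => ?_) i <;> refine Fin.cases ?_ (fun j => ?_) j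
    · simp
    · rw [Matrix.diagonal_apply_ne _ (Fin.succ_ne_zero j).symm]
      exact mem_orthogonal_span_singleton.1 (b j).2
    · rw [Matrix.diagonal_apply_ne _ (Fin.succ_ne_zero i), hs.eq]
      exact mem_orthogonal_span_singleton.1 (b i).2
    · have := hb i j
      simp only [Matrix.diagonal_apply, Fin.cons_succ, Fin.succ_inj] at this ⊢
      exact this
  rw [disc_eq_prod hb, disc_eq_prod h', Fin.prod_univ_succ]
  simp only [Fin.cons_zero, Fin.cons_succ]
  rw [mul_right_comm, quadraticChar_mul_self hv, one_mul]

end Disc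

/-! ### Vectors of given norm. -/

section Representations

variable {F : Type*} [Field F]
variable {V : Type*} [AddCommGroup V] [Module F V]

/-- The number of vectors of norm `t`. -/
noncomputable def repCount (B : LinearMap.BilinForm F V) (t : F) : ℕ :=
  Nat.card {v : V // B v v = t}

lemma repCount_eq_diagCount {B : LinearMap.BilinForm F V} {m : ℕ}
    {b : Basis (Fin m) F V} {a : Fin m → F} (hb : ∀ i j, B (b i) (b j) = Matrix.diagonal a i j)
    (t : F) : repCount B t = diagCount a t := by
  refine Nat.card_congr (b.equivFun.toEquiv.subtypeEquiv fun v => ?_)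
  have : B v v = ∑ i, a i * b.equivFun v i ^ 2 := by
    conv_lhs => rw [← b.sum_equivFun v]
    simp only [map_sum, LinearMap.sum_apply, map_smul, LinearMap.smul_apply, hb, smul_eq_mul,
      Matrix.diagonal_apply]
    refine Finset.sum_congr rfl fun i _ => ?_
    simp
    ring
  rw [this]
  rfl

variable [Fintype F] [DecidableEq F] [Module.Finite F V]

/-- The orbit-counting recursion for the orders of the orthogonal groups. -/
lemma repCount_mul_orthOrder (hF : ringChar F ≠ 2) {B : LinearMap.BilinForm F V} (hs : B.IsSymm)
    (hB : B.Nondegenerate) {n : ℕ} (hn : finrank F V = n + 1) {t : F} (ht : t ≠ 0)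
    (h1 : n = 0 → disc B = quadraticChar F t) :
    (repCount B t : ℚ) * orthOrder (Fintype.card F) (quadraticChar F (-1) : ℤ) n
        ((disc B * quadraticChar F t : ℤ) : ℚ) =
      orthOrder (Fintype.card F) (quadraticChar F (-1) : ℤ) (n + 1) (disc B : ℤ) := by
  have hq : (1 : ℚ) < Fintype.card F := by exact_mod_cast Fintype.one_lt_card
  obtain ⟨b, a, ha, hb⟩ := exists_diagonal_basis hF hs hB hn
  have hd := disc_eq_prod hb
  rw [repCount_eq_diagCount hb]
  have hc : ((quadraticChar F (-1) : ℤ) : ℚ) = 1 ∨ ((quadraticChar F (-1) : ℤ) : ℚ) = -1 := by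
    exact_mod_cast quadraticChar_dichotomy (neg_ne_zero.2 (one_ne_zero (α := F)))
  have he : ((disc B : ℤ) : ℚ) = 1 ∨ ((disc B : ℤ) : ℚ) = -1 := by
    exact_mod_cast disc_eq_one_or hB
  have hx : ((quadraticChar F t : ℤ) : ℚ) = 1 ∨ ((quadraticChar F t : ℤ) : ℚ) = -1 := by
    exact_mod_cast quadraticChar_dichotomy ht
  obtain ⟨m, rfl | rfl⟩ := n.even_or_odd'
  · have h := (diagCount_eq hF m).2 a ha t
    rw [← hd] at h
    have h' : (diagCount a t : ℚ) = (Fintype.card F : ℚ) ^ m * ((Fintype.card F : ℚ) ^ m +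
        ((quadraticChar F (-1) : ℤ) : ℚ) ^ m * ((disc B * quadraticChar F t : ℤ) : ℚ)) := by
      have : (diagCount a t : ℚ) = ((diagCount a t : ℤ) : ℚ) := by push_cast; rfl
      rw [this, h]
      push_cast
      ring
    rw [h', orthOrder_even, orthOrder_odd]
    -- This factor of the count is also the denominator of `orthOrder` in dimension `2m`. At `m = 0`
    -- it could vanish, which `h1` excludes.
    have hpos : (Fintype.card F : ℚ) ^ m +
        ((quadraticChar F (-1) : ℤ) : ℚ) ^ m * ((disc B * quadraticChar F t : ℤ) : ℚ) ≠ 0 := by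
      cases m with
      | zero =>
        rw [h1 rfl, quadraticChar_mul_self ht]
        norm_num
      | succ m =>
        refine (pow_add_pos hq hc ?_ m).ne'
        push_cast
        rcases he with he | he <;> rcases hx with hx | hx <;> rw [he, hx] <;> norm_num
    have hm : m ^ 2 = m + m * (m - 1) := by
      cases m with
      | zero => rfl
      | succ m => rw [Nat.add_sub_cancel]; ring
    rw [mul_div_assoc', div_eq_iff hpos, hm, pow_add]
    ring
  · have h := (diagCount_eq hF (m + 1)).1 a ha t
    replace hd : disc B = ∏ i : Fin (2 * (m + 1)), quadraticChar F (a i) := hd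
    rw [← hd, if_neg ht] at h
    have h' : (diagCount a t : ℚ) = (Fintype.card F : ℚ) ^ m * ((Fintype.card F : ℚ) ^ (m + 1) -
        ((quadraticChar F (-1) : ℤ) : ℚ) ^ (m + 1) * ((disc B : ℤ) : ℚ)) := by
      apply mul_left_cancel₀ (one_pos.trans hq).ne'
      have h2 := congrArg (Int.cast : ℤ → ℚ) h
      push_cast at h2
      rw [h2]
      ring
    rw [h', orthOrder_odd, show 2 * m + 1 + 1 = 2 * (m + 1) by ring,
      orthOrder_even_succ hq hc he]
    ring

end Representations

/-! ### Orthogonal frames. -/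

section Frames

variable {F : Type*} [Field F] {V : Type*} [AddCommGroup V] [Module F V]

/-- The orthogonal families of vectors with prescribed norms `a i`. -/
def Frame (B : LinearMap.BilinForm F V) {k : ℕ} (a : Fin k → F) : Type _ :=
  {v : Fin k → V // ∀ i j, B (v i) (v j) = Matrix.diagonal a i j}

instance [Finite V] (B : LinearMap.BilinForm F V) {k : ℕ} (a : Fin k → F) : Finite (Frame B a) :=
  inferInstanceAs (Finite {v : Fin k → V // ∀ i j, B (v i) (v j) = Matrix.diagonal a i j})

/-- The first vector of a frame, and the rest of it inside the orthogonal complement. -/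
def frameSuccEquiv {B : LinearMap.BilinForm F V} (hs : B.IsSymm) {k : ℕ} (a : Fin (k + 1) → F) :
    Frame B a ≃ Σ v : {v : V // B v v = a 0},
      Frame (B.restrict (B.orthogonal (F ∙ v.1))) fun i => a i.succ where
  toFun v := ⟨⟨v.1 0, by simpa using v.2 0 0⟩,
    fun i => ⟨v.1 i.succ, mem_orthogonal_span_singleton.2 <| by
      rw [v.2, Matrix.diagonal_apply_ne _ (Fin.succ_ne_zero i).symm]⟩, fun i j => by
      have := v.2 i.succ j.succ
      simp only [Matrix.diagonal_apply, Fin.succ_inj] at this ⊢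
      exact this⟩
  invFun p := ⟨Fin.cons p.1.1 fun i => (p.2.1 i : V), fun i j => by
    refine Fin.cases ?_ (fun i => ?_) i <;> refine Fin.cases ?_ (fun j => ?_) j
    · simpa using p.1.2
    · rw [Matrix.diagonal_apply_ne _ (Fin.succ_ne_zero j).symm]
      exact mem_orthogonal_span_singleton.1 (p.2.1 j).2
    · rw [Matrix.diagonal_apply_ne _ (Fin.succ_ne_zero i), hs.eq]
      exact mem_orthogonal_span_singleton.1 (p.2.1 i).2
    · have := p.2.2 i j
      simp only [Matrix.diagonal_apply, Fin.succ_inj, Fin.cons_succ] at this ⊢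
      exact this⟩
  left_inv v := Subtype.ext (Fin.cons_self_tail v.1)
  right_inv p := rfl

lemma Frame.linearIndependent {B : LinearMap.BilinForm F V} {k : ℕ} {a : Fin k → F}
    (ha : ∀ i, a i ≠ 0) (v : Frame B a) : LinearIndependent F v.1 := by
  refine LinearMap.BilinForm.linearIndependent_of_iIsOrtho (B := B) (fun i j hij => ?_) fun i => ?_
  · exact (v.2 i j).trans (Matrix.diagonal_apply_ne _ hij)
  · rw [v.2 i i, Matrix.diagonal_apply_eq]
    exact ha i

end Frames

/-! ### From frames to nondegenerate subspaces. -/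

section Counting

variable {F : Type*} [Field F] [Fintype F] [DecidableEq F]

/-- The number of frames is a quotient of orders of orthogonal groups. -/
lemma card_frame_mul_orthOrder (hF : ringChar F ≠ 2) {k : ℕ} (a : Fin k → F) (ha : ∀ i, a i ≠ 0)
    {V : Type*} [AddCommGroup V] [Module F V] [Finite V] {B : LinearMap.BilinForm F V}
    (hs : B.IsSymm) (hB : B.Nondegenerate) {l : ℕ} (hn : finrank F V = l + k)
    (hl : l = 0 → disc B = ∏ i, quadraticChar F (a i)) :
    (Nat.card (Frame B a) : ℚ) * orthOrder (Fintype.card F) (quadraticChar F (-1) : ℤ) l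
        ((disc B * ∏ i, quadraticChar F (a i) : ℤ) : ℚ) =
      orthOrder (Fintype.card F) (quadraticChar F (-1) : ℤ) (l + k) (disc B : ℤ) := by
  induction k generalizing V with
  | zero =>
    have : Nat.card (Frame B a) = 1 := by
      rw [Nat.card_eq_one_iff_unique]
      exact ⟨⟨fun v w => Subtype.ext (Subsingleton.elim _ _)⟩, ⟨⟨Fin.elim0, fun i => i.elim0⟩⟩⟩
    simp [this]
  | succ k ih =>
    have := Fintype.ofFinite {v : V // B v v = a 0}
    rw [Nat.card_congr (frameSuccEquiv hs a), Nat.card_sigma, Nat.cast_sum, Finset.sum_mul]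
    -- The contribution of the first vector depends only on its norm, since that fixes the
    -- discriminant class of the complement.
    have key : ∀ v : {v : V // B v v = a 0},
        (Nat.card (Frame (B.restrict (B.orthogonal (F ∙ v.1))) fun i => a i.succ) : ℚ) *
          orthOrder (Fintype.card F) (quadraticChar F (-1) : ℤ) l
            ((disc B * ∏ i, quadraticChar F (a i) : ℤ) : ℚ) =
        orthOrder (Fintype.card F) (quadraticChar F (-1) : ℤ) (l + k)
          ((disc B * quadraticChar F (a 0) : ℤ) : ℚ) := by
      intro v
      have hv : B v.1 v.1 ≠ 0 := by rw [v.2]; exact ha 0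
      have hd := disc_restrict_orthogonal hF hs hB hv
      rw [v.2] at hd
      have hr : finrank F (B.orthogonal (F ∙ v.1)) = l + k := by
        have := finrank_orthogonal_span_singleton hv
        omega
      rw [← hd, ← ih (fun i => a i.succ) (fun i => ha _) (hs.restrict _)
        (B.restrict_nondegenerate_orthogonal_spanSingleton hB hs.isRefl hv) hr ?_, hd,
        Fin.prod_univ_succ, mul_assoc]
      intro h0
      rw [hd, hl h0, Fin.prod_univ_succ, mul_right_comm, quadraticChar_mul_self (ha 0), one_mul]
    rw [Finset.sum_congr rfl fun v _ => key v, Finset.sum_const, nsmul_eq_mul, Finset.card_univ,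
      ← Nat.card_eq_fintype_card, ← add_assoc]
    refine repCount_mul_orthOrder hF hs hB hn (ha 0) fun h0 => ?_
    obtain ⟨rfl, rfl⟩ : l = 0 ∧ k = 0 := Nat.add_eq_zero_iff.1 h0
    simpa using hl rfl

variable {V : Type*} [AddCommGroup V] [Module F V] [Finite V]

/-- The `k`-dimensional nondegenerate subspaces with discriminant of quadratic character `δ`. -/
def nondegSubspaces (B : LinearMap.BilinForm F V) (k : ℕ) (δ : ℤ) : Set (Submodule F V) :=
  {C | finrank F C = k ∧ (B.restrict C).Nondegenerate ∧ disc (B.restrict C) = δ}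

/-- Every frame is a frame of exactly one nondegenerate subspace, namely its span. -/
lemma card_sigma_frame {B : LinearMap.BilinForm F V} {k : ℕ} {a : Fin k → F}
    (ha : ∀ i, a i ≠ 0) :
    Nat.card (Σ C : nondegSubspaces B k (∏ i, quadraticChar F (a i)), Frame (B.restrict C.1) a) =
      Nat.card (Frame B a) := by
  have hspan : ∀ (C : Submodule F V) (w : Frame (B.restrict C) a), finrank F C = k →
      Submodule.span F (Set.range fun i => (w.1 i : V)) = C := by
    intro C w hC
    have h1 : LinearIndependent F fun i => (w.1 i : V) :=
      (w.linearIndependent ha).map' C.subtype C.ker_subtype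
    refine Submodule.eq_of_le_of_finrank_eq (Submodule.span_le.2 ?_) ?_
    · rintro _ ⟨i, rfl⟩
      exact (w.1 i).2
    · rw [finrank_span_eq_card h1, Fintype.card_fin, hC]
  refine Nat.card_congr (Equiv.ofBijective
    (fun p => (⟨fun i => (p.2.1 i : V), p.2.2⟩ : Frame B a)) ⟨?_, ?_⟩)
  · rintro ⟨⟨C, hC⟩, w⟩ ⟨⟨D, hD⟩, u⟩ h
    have h' : (fun i => (w.1 i : V)) = fun i => (u.1 i : V) := congrArg Subtype.val h
    obtain rfl : C = D := by rw [← hspan C w hC.1, ← hspan D u hD.1, h']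
    congr 1
    exact Subtype.ext (funext fun i => Subtype.ext (congrFun h' i))
  · intro v
    have hli := v.linearIndependent ha
    let b := Basis.span hli
    have hb : ∀ i j, B.restrict (Submodule.span F (Set.range v.1)) (b i) (b j) =
        Matrix.diagonal a i j := by
      intro i j
      rw [← v.2 i j]
      change B (b i : V) (b j : V) = _
      rw [Basis.span_apply, Basis.span_apply]
    refine ⟨⟨⟨Submodule.span F (Set.range v.1), ?_, ?_, disc_eq_prod hb⟩, b, hb⟩, ?_⟩
    · rw [finrank_span_eq_card hli, Fintype.card_fin]
    · refine (LinearMap.BilinForm.nondegenerate_iff_det_ne_zero b).2 ?_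
      have : LinearMap.BilinForm.toMatrix b (B.restrict (Submodule.span F (Set.range v.1))) =
          Matrix.diagonal a := by
        ext i j
        rw [LinearMap.BilinForm.toMatrix_apply, hb]
      rw [this, Matrix.det_diagonal]
      exact Finset.prod_ne_zero_iff.2 fun i _ => ha i
    · exact Subtype.ext (funext fun i => congrArg Subtype.val (Basis.span_apply hli i))

/-- The number of nondegenerate subspaces of given dimension and discriminant. -/
lemma ncard_nondegSubspaces (hF : ringChar F ≠ 2) {B : LinearMap.BilinForm F V}
    (hs : B.IsSymm) (hB : B.Nondegenerate) {k l : ℕ} (hn : finrank F V = (l + 1) + (k + 1))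
    {δ : ℤ} (hδ : δ = 1 ∨ δ = -1) :
    ((nondegSubspaces B (k + 1) δ).ncard : ℚ) =
      orthOrder (Fintype.card F) (quadraticChar F (-1) : ℤ) ((l + 1) + (k + 1)) (disc B : ℤ) /
        (orthOrder (Fintype.card F) (quadraticChar F (-1) : ℤ) (k + 1) (δ : ℤ) *
          orthOrder (Fintype.card F) (quadraticChar F (-1) : ℤ) (l + 1) ((disc B * δ : ℤ) : ℚ)) := by
  have hq : (1 : ℚ) < Fintype.card F := by exact_mod_cast Fintype.one_lt_card
  have hc : ((quadraticChar F (-1) : ℤ) : ℚ) = 1 ∨ ((quadraticChar F (-1) : ℤ) : ℚ) = -1 := by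
    exact_mod_cast quadraticChar_dichotomy (neg_ne_zero.2 (one_ne_zero (α := F)))
  have hδ' : (δ : ℚ) = 1 ∨ (δ : ℚ) = -1 := by exact_mod_cast hδ
  have hdδ : ((disc B * δ : ℤ) : ℚ) = 1 ∨ ((disc B * δ : ℤ) : ℚ) = -1 := by
    rcases disc_eq_one_or hB with h | h <;> rcases hδ with h' | h' <;> rw [h, h'] <;> norm_num
  obtain ⟨g, hg0, hg⟩ : ∃ g : F, g ≠ 0 ∧ quadraticChar F g = δ := by
    rcases hδ with rfl | rfl
    · exact ⟨1, one_ne_zero, map_one _⟩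
    · obtain ⟨g, hg⟩ := quadraticChar_exists_neg_one hF
      exact ⟨g, fun h => by simp [h] at hg, hg⟩
  -- Any nonzero norms with product of class `δ` would do.
  let a : Fin (k + 1) → F := Fin.cons g fun _ => 1
  have ha : ∀ i, a i ≠ 0 := Fin.cases hg0 fun i => one_ne_zero
  have hprod : ∏ i, quadraticChar F (a i) = δ := by
    rw [Fin.prod_univ_succ]
    simp only [a, Fin.cons_zero, Fin.cons_succ, map_one, Finset.prod_const_one, mul_one, hg]
  have h1 := card_frame_mul_orthOrder hF a ha hs hB hn (fun h => absurd h (Nat.succ_ne_zero l))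
  rw [← card_sigma_frame ha, hprod] at h1
  have := Fintype.ofFinite (nondegSubspaces B (k + 1) δ)
  -- Frames filling `C` are the case `l = 0` of the frame count, with `orthOrder` equal to 1 in
  -- dimension 0.
  have hC : ∀ C : nondegSubspaces B (k + 1) δ, (Nat.card (Frame (B.restrict C.1) a) : ℚ) =
      orthOrder (Fintype.card F) (quadraticChar F (-1) : ℤ) (k + 1) (δ : ℤ) := by
    rintro ⟨C, hC1, hC2, hC3⟩
    have := card_frame_mul_orthOrder hF a ha (hs.restrict C) hC2 (l := 0) (by omega)
      (fun _ => hC3.trans hprod.symm)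
    have hsq : δ * δ = 1 := by rcases hδ with rfl | rfl <;> rfl
    rwa [hC3, hprod, hsq, Int.cast_one, orthOrder_zero, mul_one, zero_add] at this
  rw [Nat.card_sigma, Nat.cast_sum, Finset.sum_congr rfl fun C _ => hC C, Finset.sum_const,
    nsmul_eq_mul, Finset.card_univ, ← Nat.card_eq_fintype_card, Nat.card_coe_set_eq] at h1
  rw [eq_div_iff (mul_pos (orthOrder_pos hq hc hδ' k) (orthOrder_pos hq hc hdδ l)).ne', ← h1,
    mul_assoc]

end Counting

/-! ### Summing over the two discriminant classes. -/

section GaussianBinomials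

/-- Induction moving one unit from `b` to `a`, with the sum fixed. -/
lemma gaussBinom_add {x : ℚ} (hx : 1 < x) (a b : ℕ) :
    gaussBinom (a + b) a x = qFactorial x (a + b) / (qFactorial x a * qFactorial x b) := by
  induction a generalizing b with
  | zero =>
    simp only [gaussBinom, Finset.range_zero, Finset.prod_empty, zero_add]
    rw [show qFactorial x 0 = 1 by simp [qFactorial], one_mul,
      div_self (qFactorial_pos hx b).ne']
  | succ a ih =>
    have h := ih (b + 1)
    have e1 : a + 1 + b = a + (b + 1) := by ring
    have e2 : a + (b + 1) - a = b + 1 := by omega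
    rw [e1]
    unfold gaussBinom at h ⊢
    rw [Finset.prod_range_succ, h, e2, qFactorial_succ x a, qFactorial_succ x b]
    have h1 := (qFactorial_pos hx a).ne'
    have h2 := (qFactorial_pos hx b).ne'
    have h3 : x ^ (a + 1) - 1 ≠ 0 := (sub_pos.2 (one_lt_pow₀ hx (Nat.succ_ne_zero a))).ne'
    have h4 : x ^ (b + 1) - 1 ≠ 0 := (sub_pos.2 (one_lt_pow₀ hx (Nat.succ_ne_zero b))).ne'
    field_simp

variable {q c e : ℚ}

lemma inv_orthOrder_even (m : ℕ) : (orthOrder q c (2 * (m + 1)) e)⁻¹ =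
    (q ^ (m + 1) + c ^ (m + 1) * e) / (2 * q ^ ((m + 1) * m) * qFactorial (q ^ 2) (m + 1)) := by
  rw [orthOrder_even, inv_div, Nat.add_sub_cancel]

/-- The total number of nondegenerate `k`-dimensional subspaces, as a sum over the two possible
discriminant classes of the subspace; `l` is the codimension. -/
def massSum (q c e : ℚ) (k l : ℕ) : ℚ :=
  orthOrder q c (l + k) e / (orthOrder q c k 1 * orthOrder q c l (e * 1)) +
    orthOrder q c (l + k) e / (orthOrder q c k (-1) * orthOrder q c l (e * (-1)))

/-- In odd dimension `orthOrder` ignores the discriminant, so both summands agree and only the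
ambient even dimension sees `e`. -/
lemma massSum_odd_odd (hq : 1 < q) (hc : c = 1 ∨ c = -1) (he : e = 1 ∨ e = -1) (j i : ℕ) :
    massSum q c e (2 * j + 1) (2 * i + 1) =
      q ^ (2 * j * i + j + i) * (q ^ (j + i + 1) - c ^ (j + i + 1) * e) *
        gaussBinom (j + i) j (q ^ 2) := by
  have hx : 1 < q ^ 2 := one_lt_pow₀ hq two_ne_zero
  have h0 : q ≠ 0 := (one_pos.trans hq).ne'
  have h1 := (qFactorial_pos hx j).ne'
  have h2 := (qFactorial_pos hx i).ne'
  rw [massSum, show 2 * i + 1 + (2 * j + 1) = 2 * (j + i + 1) by ring,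
    orthOrder_even_succ hq hc he, gaussBinom_add hx]
  simp only [orthOrder_odd]
  rw [show (j + i + 1) * (j + i) = j ^ 2 + i ^ 2 + (2 * j * i + j + i) by ring, pow_add q,
    pow_add q (j ^ 2)]
  field_simp
  ring

/-- Only the complement sees the class, through numerators `q^(i+1) ± c^(i+1) e`, which add up to `2
q^(i+1)`. -/
lemma massSum_odd_even (hq : 1 < q) (j i : ℕ) :
    massSum q c e (2 * j + 1) (2 * (i + 1)) =
      q ^ (2 * (j + 1) * (i + 1)) * gaussBinom (j + (i + 1)) j (q ^ 2) := by
  have hx : 1 < q ^ 2 := one_lt_pow₀ hq two_ne_zero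
  have h0 : q ≠ 0 := (one_pos.trans hq).ne'
  have h1 := (qFactorial_pos hx j).ne'
  have h2 := (qFactorial_pos hx (i + 1)).ne'
  rw [massSum, show 2 * (i + 1) + (2 * j + 1) = 2 * (j + (i + 1)) + 1 by ring,
    gaussBinom_add hx]
  simp only [div_eq_mul_inv, mul_inv (orthOrder _ _ _ _), inv_orthOrder_even]
  simp only [orthOrder_odd]
  have hexp : q ^ ((j + (i + 1)) ^ 2) * q ^ (i + 1) =
      q ^ (2 * (j + 1) * (i + 1)) * q ^ (j ^ 2) * q ^ ((i + 1) * i) := by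
    simp only [← pow_add]; congr 1; ring
  field_simp
  linear_combination 2 * hexp

/-- The same cancellation, now in the factor of the subspace. -/
lemma massSum_even_odd (hq : 1 < q) (j i : ℕ) :
    massSum q c e (2 * (j + 1)) (2 * i + 1) =
      q ^ (2 * (j + 1) * (i + 1)) * gaussBinom ((j + 1) + i) (j + 1) (q ^ 2) := by
  have hx : 1 < q ^ 2 := one_lt_pow₀ hq two_ne_zero
  have h0 : q ≠ 0 := (one_pos.trans hq).ne'
  have h1 := (qFactorial_pos hx (j + 1)).ne'
  have h2 := (qFactorial_pos hx i).ne'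
  rw [massSum, show 2 * i + 1 + 2 * (j + 1) = 2 * ((j + 1) + i) + 1 by ring,
    gaussBinom_add hx]
  simp only [div_eq_mul_inv, mul_inv (orthOrder _ _ _ _), inv_orthOrder_even]
  simp only [orthOrder_odd]
  have hexp : q ^ (((j + 1) + i) ^ 2) * q ^ (j + 1) =
      q ^ (2 * (j + 1) * (i + 1)) * q ^ (i ^ 2) * q ^ ((j + 1) * j) := by
    simp only [← pow_add]; congr 1; ring
  field_simp
  linear_combination 2 * hexp

/-- With `X = q^(j+1)`, `Y = q^(i+1)`, the identity `(X + α)(Y + β) + (X - α)(Y - β) = 2(XY + αβ)`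
produces exactly the ambient denominator, which cancels. -/
lemma massSum_even_even (hq : 1 < q) (hc : c = 1 ∨ c = -1) (he : e = 1 ∨ e = -1) (j i : ℕ) :
    massSum q c e (2 * (j + 1)) (2 * (i + 1)) =
      q ^ (2 * (j + 1) * (i + 1)) * gaussBinom ((j + 1) + (i + 1)) (j + 1) (q ^ 2) := by
  have hx : 1 < q ^ 2 := one_lt_pow₀ hq two_ne_zero
  have h0 : q ≠ 0 := (one_pos.trans hq).ne'
  have h1 := (qFactorial_pos hx (j + 1)).ne'
  have h2 := (qFactorial_pos hx (i + 1)).ne'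
  have h3 := (pow_add_pos hq hc he (j + i + 1)).ne'
  rw [massSum, show 2 * (i + 1) + 2 * (j + 1) = 2 * (j + i + 1 + 1) by ring,
    gaussBinom_add hx]
  simp only [div_eq_mul_inv, mul_inv (orthOrder _ _ _ _), inv_orthOrder_even]
  rw [orthOrder_even, Nat.add_sub_cancel, show j + 1 + (i + 1) = j + i + 1 + 1 by ring]
  have hexp : q ^ ((j + i + 1 + 1) * (j + i + 1)) =
      q ^ (2 * (j + 1) * (i + 1)) * q ^ ((j + 1) * j) * q ^ ((i + 1) * i) := by
    simp only [← pow_add]; congr 1; ring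
  have hsum : (q ^ (j + 1) + c ^ (j + 1) * 1) * (q ^ (i + 1) + c ^ (i + 1) * (e * 1)) +
      (q ^ (j + 1) + c ^ (j + 1) * -1) * (q ^ (i + 1) + c ^ (i + 1) * (e * -1)) =
      2 * (q ^ (j + i + 1 + 1) + c ^ (j + i + 1 + 1) * e) := by ring
  rw [hexp]
  -- The binomials become atoms, so that `field_simp` does not expand them.
  generalize q ^ (j + i + 1 + 1) + c ^ (j + i + 1 + 1) * e = D at *
  generalize q ^ (j + 1) + c ^ (j + 1) * 1 = x at *
  generalize q ^ (j + 1) + c ^ (j + 1) * -1 = x' at *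
  generalize q ^ (i + 1) + c ^ (i + 1) * (e * 1) = y at *
  generalize q ^ (i + 1) + c ^ (i + 1) * (e * -1) = y' at *
  field_simp
  linear_combination qFactorial (q ^ 2) (j + i + 1 + 1) * hsum

end GaussianBinomials

/-! ### The closed formula for any nondegenerate symmetric matrix. -/

section ClosedForm

variable {F : Type*} [Field F] [Fintype F] [DecidableEq F]

/-- The number of LCD codes of a form, as a sum over the discriminant classes. -/
lemma lcdCount_eq_massSum (hF : ringChar F ≠ 2) {n : ℕ} {M : Matrix (Fin n) (Fin n) F}
    (hs : M.IsSymm) (hM : M.det ≠ 0) {k l : ℕ} (hn : n = (l + 1) + (k + 1)) :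
    (lcdCount M (k + 1) : ℚ) = massSum (Fintype.card F) (quadraticChar F (-1) : ℤ)
      (quadraticChar F M.det : ℤ) (k + 1) (l + 1) := by
  set B := Matrix.toBilin' M with hBdef
  have hsB : B.IsSymm := Matrix.isSymm_toBilin'_iff_isSymm.2 hs
  have hB : B.Nondegenerate := LinearMap.BilinForm.nondegenerate_toBilin'_of_det_ne_zero' M hM
  have hd : disc B = quadraticChar F M.det := by
    rw [disc_eq B (Pi.basisFun F (Fin n)), LinearMap.BilinForm.toMatrix_basisFun, hBdef,
      LinearMap.BilinForm.toMatrix'_toBilin']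
  have hlcd : ∀ C, IsLCD M C ↔ (B.restrict C).Nondegenerate := fun C =>
    ⟨fun h => B.nondegenerate_restrict_of_disjoint_orthogonal hsB.isRefl (disjoint_iff.2 h),
      fun h => (LinearMap.BilinForm.isCompl_orthogonal_of_restrict_nondegenerate
        hsB.isRefl h).inf_eq_bot⟩
  have hunion : {C : Submodule F (Fin n → F) | Module.finrank F C = k + 1 ∧ IsLCD M C} =
      nondegSubspaces B (k + 1) 1 ∪ nondegSubspaces B (k + 1) (-1) := by
    ext C
    constructor
    · rintro ⟨h1, h2⟩
      have h3 := (hlcd C).1 h2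
      exact (disc_eq_one_or h3).imp (fun h => ⟨h1, h3, h⟩) (fun h => ⟨h1, h3, h⟩)
    · rintro (⟨h1, h2, -⟩ | ⟨h1, h2, -⟩) <;> exact ⟨h1, (hlcd C).2 h2⟩
  have hdisj : Disjoint (nondegSubspaces B (k + 1) 1) (nondegSubspaces B (k + 1) (-1)) := by
    refine Set.disjoint_left.2 fun C h1 h2 => ?_
    have := h1.2.2.symm.trans h2.2.2
    norm_num at this
  have hfin : Module.finrank F (Fin n → F) = (l + 1) + (k + 1) := by simp [hn]
  rw [lcdCount, hunion, Set.ncard_union_eq hdisj, Nat.cast_add,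
    ncard_nondegSubspaces hF hsB hB hfin (Or.inl rfl),
    ncard_nondegSubspaces hF hsB hB hfin (Or.inr rfl), hd, massSum]
  push_cast
  rfl

/-- The mass formula for the LCD codes of an arbitrary nondegenerate symmetric form. -/
theorem lcdCount_eq (hF : ringChar F ≠ 2) {n : ℕ} {M : Matrix (Fin n) (Fin n) F}
    (hs : M.IsSymm) (hM : M.det ≠ 0) {k : ℕ} (hk : 1 ≤ k) (hkn : k < n) :
    (lcdCount M k : ℚ) =
      if Odd k ∧ Even n then oddEvenMass n k M.det else carletMass F n k := by
  have hq : (1 : ℚ) < Fintype.card F := by exact_mod_cast Fintype.one_lt_card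
  have hc : ((quadraticChar F (-1) : ℤ) : ℚ) = 1 ∨ ((quadraticChar F (-1) : ℤ) : ℚ) = -1 := by
    exact_mod_cast quadraticChar_dichotomy (neg_ne_zero.2 (one_ne_zero (α := F)))
  have he : ((quadraticChar F M.det : ℤ) : ℚ) = 1 ∨ ((quadraticChar F M.det : ℤ) : ℚ) = -1 := by
    exact_mod_cast quadraticChar_dichotomy hM
  obtain ⟨k, rfl⟩ := Nat.exists_eq_add_of_le' hk
  obtain ⟨l, hn⟩ : ∃ l, n = (l + 1) + (k + 1) := ⟨n - (k + 1) - 1, by omega⟩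
  rw [lcdCount_eq_massSum hF hs hM hn]
  -- The dimension is now `k + 1` and the codimension `l + 1`, so even `k` means odd dimension.
  obtain ⟨j, rfl | rfl⟩ := k.even_or_odd' <;> obtain ⟨i, rfl | rfl⟩ := l.even_or_odd'
  · have hn2 : n / 2 = j + i + 1 := by omega
    have e1 : n - (2 * j + 1) = 2 * i + 1 := by omega
    have e2 : ((2 * j + 1) * (2 * i + 1) - 1) / 2 = 2 * j * i + j + i := by
      rw [show (2 * j + 1) * (2 * i + 1) = 2 * (2 * j * i + j + i) + 1 by ring]; omega
    have e3 : (2 * j + 1 - 1) / 2 = j := by omega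
    rw [if_pos ⟨odd_two_mul_add_one j, Nat.even_iff.2 (by omega)⟩, massSum_odd_odd hq hc he,
      oddEvenMass, e1, e2, e3, hn2, Nat.add_sub_cancel, map_mul, map_pow]
    push_cast
    rfl
  · have hno : ¬ Even n := Nat.not_even_iff.2 (by omega)
    have hn2 : (n - 1) / 2 = j + (i + 1) := by omega
    have e1 : n - (2 * j + 1) = 2 * (i + 1) := by omega
    have e2 : (2 * j + 1 + 1) * (2 * (i + 1)) / 2 = 2 * (j + 1) * (i + 1) := by
      rw [show (2 * j + 1 + 1) * (2 * (i + 1)) = 2 * (2 * (j + 1) * (i + 1)) by ring]; omega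
    have e3 : (2 * j + 1 - 1) / 2 = j := by omega
    rw [if_neg fun h => hno h.2, show 2 * i + 1 + 1 = 2 * (i + 1) by ring, massSum_odd_even hq,
      carletMass, if_pos (odd_two_mul_add_one j), if_neg hno, e1, e2, e3, hn2]
  · have hno : ¬ Even n := Nat.not_even_iff.2 (by omega)
    have hko : ¬ Odd (2 * j + 1 + 1) := Nat.not_odd_iff.2 (by omega)
    have hn2 : (n - 1) / 2 = (j + 1) + i := by omega
    have e1 : n - (2 * j + 1 + 1) + 1 = 2 * (i + 1) := by omega
    have e2 : (2 * j + 1 + 1) * (2 * (i + 1)) / 2 = 2 * (j + 1) * (i + 1) := by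
      rw [show (2 * j + 1 + 1) * (2 * (i + 1)) = 2 * (2 * (j + 1) * (i + 1)) by ring]; omega
    have e3 : (2 * j + 1 + 1) / 2 = j + 1 := by omega
    rw [if_neg fun h => hno h.2, carletMass, if_neg hko, if_neg hno, e1, e2, e3, hn2,
      show 2 * j + 1 + 1 = 2 * (j + 1) by ring, massSum_even_odd hq]
  · have hne : Even n := Nat.even_iff.2 (by omega)
    have hko : ¬ Odd (2 * j + 1 + 1) := Nat.not_odd_iff.2 (by omega)
    have hn2 : n / 2 = (j + 1) + (i + 1) := by omega
    have e1 : n - (2 * j + 1 + 1) = 2 * (i + 1) := by omega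
    have e2 : (2 * j + 1 + 1) * (2 * (i + 1)) / 2 = 2 * (j + 1) * (i + 1) := by
      rw [show (2 * j + 1 + 1) * (2 * (i + 1)) = 2 * (2 * (j + 1) * (i + 1)) by ring]; omega
    have e3 : (2 * j + 1 + 1) / 2 = j + 1 := by omega
    rw [if_neg fun h => hko h.1, carletMass, if_neg hko, if_pos hne, e1, e2, e3, hn2,
      show 2 * j + 1 + 1 = 2 * (j + 1) by ring, show 2 * i + 1 + 1 = 2 * (i + 1) by ring,
      massSum_even_even hq hc he]

lemma oddEvenMass_congr {d d' : F} (h : quadraticChar F d = quadraticChar F d') (n k : ℕ) :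
    oddEvenMass n k d = oddEvenMass n k d' := by
  rw [oddEvenMass, oddEvenMass, map_mul, map_mul, h]

end ClosedForm

/-! ### The model forms and their determinants. -/

section Types

variable {F : Type*} [Field F]

lemma structMatrix_isSymm (n : ℕ) (γ : F) (ε : ℤˣ) : (structMatrix n γ ε).IsSymm :=
  Matrix.isSymm_diagonal _

lemma structMatrix_one (n : ℕ) (γ : F) : structMatrix n γ 1 = 1 := by
  simp [structMatrix, tau]

lemma det_structMatrix {n : ℕ} (hn : 0 < n) (γ : F) (ε : ℤˣ) :
    (structMatrix n γ ε).det = tau γ ε := by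
  obtain ⟨n, rfl⟩ := Nat.exists_eq_add_of_le' hn
  rw [structMatrix, Matrix.det_diagonal, Fin.prod_univ_castSucc]
  have : ∀ i : Fin n, i.val ≠ n := fun i => i.isLt.ne
  simp [this]

lemma tau_ne_zero {γ : F} (hγ : γ ≠ 0) (ε : ℤˣ) : tau γ ε ≠ 0 := by
  unfold tau
  split_ifs
  · exact one_ne_zero
  · exact hγ

end Types

end LCDMass

theorem theoremB3 {F : Type*} [Field F] [Fintype F] [DecidableEq F]
    (hq : Odd (Fintype.card F)) (γ : F) (hγ : ¬ IsSquare γ) (ε : ℤˣ)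
    (n k : ℕ) (hk : 1 ≤ k) (hkn : k < n) :
    ((LCDMass.typeCount γ ε n k : ℚ) =
        if Odd k ∧ Even n then LCDMass.oddEvenMass n k (LCDMass.tau γ ε)
        else (LCDMass.stdCount F n k : ℚ)) ∧
      (LCDMass.stdCount F n k : ℚ) = LCDMass.carletMass F n k ∧
      LCDMass.typeCount γ 1 n k = LCDMass.stdCount F n k ∧
      (∀ M : Matrix (Fin n) (Fin n) F, LCDMass.IsOfType γ ε M →
        LCDMass.lcdCount M k = LCDMass.typeCount γ ε n k) := by
  have hF : ringChar F ≠ 2 := fun h => by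
    have := FiniteField.even_card_of_char_two h
    rw [Nat.odd_iff] at hq
    omega
  have hγ0 : γ ≠ 0 := fun h => hγ (h ▸ IsSquare.zero)
  have hdet := LCDMass.det_structMatrix (Nat.zero_lt_of_lt hkn) γ ε
  have hdet0 : (LCDMass.structMatrix n γ ε).det ≠ 0 := hdet ▸ LCDMass.tau_ne_zero hγ0 ε
  have htype := LCDMass.lcdCount_eq hF (LCDMass.structMatrix_isSymm n γ ε) hdet0 hk hkn
  have hstd : (LCDMass.stdCount F n k : ℚ) = LCDMass.carletMass F n k := by
    rw [LCDMass.stdCount, LCDMass.lcdCount_eq hF Matrix.isSymm_one (by simp) hk hkn,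
      Matrix.det_one]
    split_ifs with h
    · rw [LCDMass.carletMass, if_pos h.1, if_pos h.2]
    · rfl
  refine ⟨?_, hstd, ?_, ?_⟩
  · rw [LCDMass.typeCount, htype, hdet, hstd]
  · rw [LCDMass.typeCount, LCDMass.structMatrix_one, LCDMass.stdCount]
  · rintro M ⟨P, rfl⟩
    have hP : P.val.det ≠ 0 := (Matrix.isUnit_iff_isUnit_det _).1 P.isUnit |>.ne_zero
    have hM : (P.val * LCDMass.structMatrix n γ ε * P.val.transpose).det =
        P.val.det * P.val.det * (LCDMass.structMatrix n γ ε).det := by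
      rw [Matrix.det_mul, Matrix.det_mul, Matrix.det_transpose]
      ring
    have hs : (P.val * LCDMass.structMatrix n γ ε * P.val.transpose).IsSymm := by
      rw [Matrix.IsSymm, Matrix.transpose_mul, Matrix.transpose_mul, Matrix.transpose_transpose,
        LCDMass.structMatrix_isSymm, Matrix.mul_assoc]
    have hM0 : (P.val * LCDMass.structMatrix n γ ε * P.val.transpose).det ≠ 0 := by
      rw [hM]
      exact mul_ne_zero (mul_ne_zero hP hP) hdet0
    -- The isometry enters only through the determinant class; no bijection of subspaces is needed.
    have hχ : quadraticChar F (P.val * LCDMass.structMatrix n γ ε * P.val.transpose).det =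
        quadraticChar F (LCDMass.structMatrix n γ ε).det := by
      rw [hM, map_mul, map_mul, LCDMass.quadraticChar_mul_self hP, one_mul]
    have h : (LCDMass.lcdCount (P.val * LCDMass.structMatrix n γ ε * P.val.transpose) k : ℚ) =
        LCDMass.typeCount γ ε n k := by
      rw [LCDMass.typeCount, htype, LCDMass.lcdCount_eq hF hs hM0 hk hkn,
        LCDMass.oddEvenMass_congr hχ]
    exact_mod_cast h
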